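/- Let $R$ be a commutative Noetherian ring with identity and $\mathfrak a$ an ideal of $R$. For $R$-modules $M,N$ let $H^i_{\mathfrak a}(M,N)=\varinjlim_n \operatorname{Ext}^i_R(M/\mathfrak a^nM,N)$ denote generalized local cohomology and $H^i_{\mathfrak a}(M)$ the usual local cohomology. For finitely generated $M,N$ put $f_{\mathfrak a}(M,N)=\inf\{i\ge 0: H^i_{\mathfrak a}(M,N)\text{ is not finitely generated}\}$ and $f_{\mathfrak a}(M)=\inf\{i\ge 0: H^i_{\mathfrak a}(M)\text{ is not finitely generated}\}$, with $\inf\emptyset=+\infty$. Let $\Gamma_{\mathfrak a}(M)=\{x\in M: \mathfrak a^n x=0\text{ for some }n\}$. Let $L,M,N$ be finitely generated $R$-modules. (i) If $0\to L\to M\to N\to 0$ is an exact sequence, then for every finitely generated $R$-module $C$, $f_{\mathfrak a}(M,C)=\inf\{f_{\mathfrak a}(L,C),f_{\mathfrak a}(N,C)\}$. (ii) $f_{\mathfrak a}(M)=\inf\{f_{\mathfrak a}(C,M): C\text{ is a finitely generated }R\text{-module}\}$. (iii) $f_{\mathfrak a}(M,L)=\inf\{f_{\mathfrak a}(R/\mathfrak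 p,L):\mathfrak p\in\operatorname{Supp}_R M\}$. (iv) If $\operatorname{Supp}_R(M/\Gamma_{\mathfrak a}(M))\subseteq\operatorname{Supp}_R(N/\Gamma_{\mathfrak a}(N))$, then $f_{\mathfrak a}(M,L)\ge f_{\mathfrak a}(N,L)$. In particular, if these two supports are equal, then $f_{\mathfrak a}(M,L)=f_{\mathfrak a}(N,L)$. -/

import Mathlib

universe u

noncomputable section

open CategoryTheory Abelian

section FinitenessDimension

variable {R : Type u} [CommRing R] (a : Ideal R)

/-- The natural projection `M / aⁿM → M / aᵐM` for `m ≤ n`. -/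
def powQuotientMap (M : Type u) [AddCommGroup M] [Module R M] {m n : ℕ} (h : m ≤ n) :
    (M ⧸ (a ^ n • ⊤ : Submodule R M)) →ₗ[R] (M ⧸ (a ^ m • ⊤ : Submodule R M)) :=
  Submodule.factor (Submodule.smul_mono_left (Ideal.pow_le_pow_right h))

/-- The transition map `Extⁱ(M / aᵐM, N) → Extⁱ(M / aⁿM, N)` for `m ≤ n`, induced by the natural
projection `M / aⁿM → M / aᵐM`. -/
def extPowTransition (M N : Type u) [AddCommGroup M] [Module R M] [AddCommGroup N] [Module R N]
    (i m n : ℕ) (h : m ≤ n) :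
    Ext (ModuleCat.of R (M ⧸ (a ^ m • ⊤ : Submodule R M))) (ModuleCat.of R N) i →ₗ[R]
      Ext (ModuleCat.of R (M ⧸ (a ^ n • ⊤ : Submodule R M))) (ModuleCat.of R N) i :=
  (Ext.mk₀ (ModuleCat.ofHom (powQuotientMap a M h))).precompOfLinear R (ModuleCat.of R N)
    (zero_add i)

/-- The modules `Extⁱ(M / aⁿM, N)`, `n ∈ ℕ`, form a direct system. -/
instance extPowDirectedSystem (M N : Type u) [AddCommGroup M] [Module R M] [AddCommGroup N]
    [Module R N] (i : ℕ) :
    DirectedSystem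
      (fun n : ℕ =>
        Ext (ModuleCat.of R (M ⧸ (a ^ n • ⊤ : Submodule R M))) (ModuleCat.of R N) i)
      (fun m n h => extPowTransition a M N i m n h) where
  map_self n x := by
    have h : ModuleCat.ofHom (powQuotientMap a M (le_refl n)) = 𝟙 _ := by
      ext y
      rfl
    simp [extPowTransition, h]
  map_map k j n hij hjk x := by
    have h : ModuleCat.ofHom (powQuotientMap a M hjk) ≫ ModuleCat.ofHom (powQuotientMap a M hij)
        = ModuleCat.ofHom (powQuotientMap a M (hij.trans hjk)) := by
      ext y
      rfl
    simp [extPowTransition, h]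

/-- Generalized local cohomology `Hⁱ_a(M, N)`: the direct limit over `n` of `Extⁱ(M / aⁿM, N)`. -/
abbrev genLocalCohomology (M N : Type u) [AddCommGroup M] [Module R M] [AddCommGroup N]
    [Module R N] (i : ℕ) : Type u :=
  Module.DirectLimit
    (fun n : ℕ =>
      Ext (ModuleCat.of R (M ⧸ (a ^ n • ⊤ : Submodule R M))) (ModuleCat.of R N) i)
    (extPowTransition a M N i)

/-- The finiteness dimension `f_a(M, N)` of a pair of modules: the infimum of all `i` such that
`Hⁱ_a(M, N)` is not finitely generated (`⊤` if there is no such `i`). -/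
def pairFinitenessDim (M N : Type u) [AddCommGroup M] [Module R M] [AddCommGroup N]
    [Module R N] : ℕ∞ :=
  ⨅ (i : ℕ) (_ : ¬ Module.Finite R (genLocalCohomology a M N i)), (i : ℕ∞)

/-- The finiteness dimension `f_a(M)` of a module: the infimum of all `i` such that the local
cohomology module `Hⁱ_a(M)` is not finitely generated (`⊤` if there is no such `i`). -/
def finitenessDim (M : Type u) [AddCommGroup M] [Module R M] : ℕ∞ :=
  ⨅ (i : ℕ) (_ : ¬ Module.Finite R ((localCohomology a i).obj (ModuleCat.of R M))), (i : ℕ∞)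

end FinitenessDimension

end

/-!
The modules `Hⁱ_a(M, C) = colim_n Extⁱ(M / aⁿM, C)` behave in the variable `M` like a contravariant
cohomological functor on finitely generated modules. Indeed a short exact sequence
`0 → L → M → N → 0` gives short exact sequences `0 → L / (L ∩ aⁿM) → M / aⁿM → N / aⁿN → 0`,
compatible with the projections; the long exact sequences of `Ext` pass to the colimit, and by the
Artin-Rees lemma (`exists_comap_pow_smul_top_le`) the systems `L / (L ∩ aⁿM)` and `L / aⁿL` are
pro-isomorphic, so they have the same `colim Ext` (`ExtColim.map_bijective`). Over a Noetherian ring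
this yields three finiteness statements (`finite_genLocalCohomology_of_exact`,
`finite_genLocalCohomology_succ_right`, `finite_genLocalCohomology_zero_right`), and they are all
that is needed about long exact sequences.

The heart of the matter is `pairFinitenessDim_le_of_support_subset`: if `Supp N ⊆ Supp M`, then
`f_a(M, C) ≤ f_a(N, C)`. By induction on `t`, suppose that the claim holds for the bound `t`, and
that `Hⁱ_a(M, C)` is finitely generated for `i ≤ t`. The kernel of a surjection `M → Q` is supported
in `Supp M`, so its cohomology is finitely generated in degrees `< t`, and the long exact sequence
gives the finiteness of `Hⁱ_a(Q, C)` for `i ≤ t`. Now let `p ∈ Supp M`. There is a nonzero map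
`M → R / p` (`exists_ne_zero_of_mem_support`); its image is a quotient of `M`, and its cokernel is
supported at primes of `Supp M` strictly above `p`. Noetherian induction on `p` together with prime
filtrations handles the cokernel, hence `R / p`; prime filtrations once more give every `N` with
support in `Supp M`.

The four assertions follow formally, given two complements. Modules killed by a power of `a` have
finitely generated generalized local cohomology in all degrees, so `Γ_a(M)` can be divided out. And
`Hⁱ_a(R, M)` is the usual `Hⁱ_a(M)`; since local cohomology in Mathlib is built from the
derived functors of `Hom(-, M)` rather than from the `Ext` groups of the derived category, this
needs an isomorphism between the two, natural in the first variable
(`CategoryTheory.ProjectiveResolution.extLinearEquiv_naturality`): both are computed by cocycles of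
`Hom(P, M)` for a projective resolution `P`.
-/

noncomputable section

open CategoryTheory Abelian

/-! ### Colimits of `Ext` along inverse systems -/

section ExtColim

open Opposite

universe t w v' u'

variable (R : Type t) [CommRing R] {𝒞 : Type u'} [Category.{v'} 𝒞] [Abelian 𝒞] [Linear R 𝒞]
  [HasExt.{w} 𝒞]

/-- The transition map `Extⁱ(Xₘ, Y) → Extⁱ(Xₙ, Y)`, `m ≤ n`, of an inverse system `X`. -/
def extColimTransition (X : ℕᵒᵖ ⥤ 𝒞) (Y : 𝒞) (i m n : ℕ) (h : m ≤ n) :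
    Ext (X.obj (op m)) Y i →ₗ[R] Ext (X.obj (op n)) Y i :=
  (Ext.mk₀ (X.map (homOfLE h).op)).precompOfLinear R Y (zero_add i)

instance extColimDirectedSystem (X : ℕᵒᵖ ⥤ 𝒞) (Y : 𝒞) (i : ℕ) :
    DirectedSystem (fun n => Ext (X.obj (op n)) Y i)
      (fun m n h => extColimTransition R X Y i m n h) where
  map_self n x := by
    simp [extColimTransition]
  map_map k j n hij hjk x := by
    have h : X.map (homOfLE hjk).op ≫ X.map (homOfLE hij).op =
        X.map (homOfLE (hij.trans hjk)).op := by
      rw [← X.map_comp]; rfl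
    simp [extColimTransition, h]

/-- The module `colim_n Extⁱ(Xₙ, Y)` attached to an inverse system `X` indexed by `ℕ`. -/
abbrev ExtColim (X : ℕᵒᵖ ⥤ 𝒞) (Y : 𝒞) (i : ℕ) : Type w :=
  Module.DirectLimit (fun n => Ext (X.obj (op n)) Y i) (extColimTransition R X Y i)

/-- The canonical map `Extⁱ(Xₙ, Y) → colim_n Extⁱ(Xₙ, Y)`. -/
abbrev ExtColim.of (X : ℕᵒᵖ ⥤ 𝒞) (Y : 𝒞) (i n : ℕ) :
    Ext (X.obj (op n)) Y i →ₗ[R] ExtColim R X Y i :=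
  Module.DirectLimit.of R ℕ (fun n => Ext (X.obj (op n)) Y i) (extColimTransition R X Y i) n

variable {R}

lemma ExtColim.of_transition (X : ℕᵒᵖ ⥤ 𝒞) (Y : 𝒞) (i : ℕ) {m n : ℕ} (h : m ≤ n)
    (x : Ext (X.obj (op m)) Y i) :
    ExtColim.of R X Y i n ((Ext.mk₀ (X.map (homOfLE h).op)).comp x (zero_add i)) =
      ExtColim.of R X Y i m x :=
  Module.DirectLimit.of_f (f := extColimTransition R X Y i) (hij := h) (x := x)

lemma ExtColim.exists_transition_eq_zero {X : ℕᵒᵖ ⥤ 𝒞} {Y : 𝒞} {i m : ℕ}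
    {x : Ext (X.obj (op m)) Y i} (hx : ExtColim.of R X Y i m x = 0) :
    ∃ (n : ℕ) (h : m ≤ n), (Ext.mk₀ (X.map (homOfLE h).op)).comp x (zero_add i) = 0 :=
  Module.DirectLimit.of.zero_exact (f := extColimTransition R X Y i) hx

variable (R)

/-- A morphism of inverse systems `X ⟶ X'` induces `colim Extⁱ(X'ₙ, Y) → colim Extⁱ(Xₙ, Y)`. -/
def ExtColim.map {X X' : ℕᵒᵖ ⥤ 𝒞} (α : X ⟶ X') (Y : 𝒞) (i : ℕ) :
    ExtColim R X' Y i →ₗ[R] ExtColim R X Y i :=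
  Module.DirectLimit.map
    (fun n => (Ext.mk₀ (α.app (op n))).precompOfLinear R Y (zero_add i)) (fun m n h => by
      ext x
      simp [extColimTransition])

variable {R}

@[simp]
lemma ExtColim.map_of {X X' : ℕᵒᵖ ⥤ 𝒞} (α : X ⟶ X') (Y : 𝒞) (i n : ℕ)
    (x : Ext (X'.obj (op n)) Y i) :
    ExtColim.map R α Y i (ExtColim.of R X' Y i n x) =
      ExtColim.of R X Y i n ((Ext.mk₀ (α.app (op n))).comp x (zero_add i)) :=
  Module.DirectLimit.map_apply_of _ _ _

/-- A pro-isomorphism of inverse systems induces a bijection on `colim Ext`: it suffices that the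
transition maps of the two systems factor compatibly through `α`. -/
lemma ExtColim.map_bijective {X X' : ℕᵒᵖ ⥤ 𝒞} (α : X ⟶ X') (Y : 𝒞) (i : ℕ)
    (h : ∀ n, ∃ (m : ℕ) (hnm : n ≤ m) (s : X'.obj (op m) ⟶ X.obj (op n)),
      s ≫ α.app (op n) = X'.map (homOfLE hnm).op ∧
      α.app (op m) ≫ s = X.map (homOfLE hnm).op) :
    Function.Bijective (ExtColim.map R α Y i) := by
  constructor
  · rw [injective_iff_map_eq_zero]
    intro z hz
    obtain ⟨n, x, rfl⟩ := Module.DirectLimit.exists_of z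
    rw [ExtColim.map_of] at hz
    obtain ⟨k, hnk, hk⟩ := ExtColim.exists_transition_eq_zero hz
    obtain ⟨m, hkm, s, hs, -⟩ := h k
    have hX : s ≫ X.map (homOfLE hnk).op ≫ α.app (op n) = X'.map (homOfLE (hnk.trans hkm)).op := by
      rw [α.naturality, reassoc_of% hs, ← X'.map_comp]; rfl
    rw [← ExtColim.of_transition X' Y i (hnk.trans hkm), ← hX, ← Ext.mk₀_comp_mk₀_assoc,
      ← Ext.mk₀_comp_mk₀_assoc, hk, Ext.comp_zero, map_zero]
  · intro z
    obtain ⟨n, x, rfl⟩ := Module.DirectLimit.exists_of z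
    obtain ⟨m, hnm, s, -, hs⟩ := h n
    refine ⟨ExtColim.of R X' Y i m ((Ext.mk₀ s).comp x (zero_add i)), ?_⟩
    rw [ExtColim.map_of, Ext.mk₀_comp_mk₀_assoc, hs, ExtColim.of_transition]

/-- If the inverse system is constant from `k` on, then `Extⁱ(Xₖ, Y)` maps onto the colimit. -/
lemma ExtColim.of_surjective (X : ℕᵒᵖ ⥤ 𝒞) (Y : 𝒞) (i k : ℕ)
    (h : ∀ (n : ℕ) (hn : k ≤ n), IsIso (X.map (homOfLE hn).op)) :
    Function.Surjective (ExtColim.of R X Y i k) := by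
  intro z
  obtain ⟨n, x, rfl⟩ := Module.DirectLimit.exists_of z
  have := h (max k n) (le_max_left k n)
  refine ⟨(Ext.mk₀ (inv (X.map (homOfLE (le_max_left k n)).op))).comp
    ((Ext.mk₀ (X.map (homOfLE (le_max_right k n)).op)).comp x (zero_add i)) (zero_add i), ?_⟩
  rw [← ExtColim.of_transition X Y i (le_max_left k n), Ext.mk₀_comp_mk₀_assoc, IsIso.hom_inv_id,
    Ext.mk₀_id_comp, ExtColim.of_transition]

section LongExact

variable {X₁ X₂ X₃ : ℕᵒᵖ ⥤ 𝒞} (α : X₁ ⟶ X₂) (β : X₂ ⟶ X₃) (w : ∀ n, α.app n ≫ β.app n = 0)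
  (hS : ∀ n, (ShortComplex.mk _ _ (w n)).ShortExact) (Y : 𝒞)

include w hS

/-- Exactness of `colim Extⁱ(X₃, Y) → colim Extⁱ(X₂, Y) → colim Extⁱ(X₁, Y)`. -/
lemma ExtColim.exact_map_map (i : ℕ) :
    Function.Exact (ExtColim.map R β Y i) (ExtColim.map R α Y i) := by
  intro z
  constructor
  · intro hz
    obtain ⟨n, x, rfl⟩ := Module.DirectLimit.exists_of z
    rw [ExtColim.map_of] at hz
    obtain ⟨m, hnm, hm⟩ := ExtColim.exists_transition_eq_zero hz
    rw [Ext.mk₀_comp_mk₀_assoc, α.naturality, ← Ext.mk₀_comp_mk₀_assoc] at hm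
    obtain ⟨y, hy⟩ := Ext.contravariant_sequence_exact₂ (hS (op m)) Y _ hm
    refine ⟨ExtColim.of R X₃ Y i m y, ?_⟩
    rw [ExtColim.map_of]
    exact (congrArg _ hy).trans (ExtColim.of_transition X₂ Y i hnm x)
  · rintro ⟨z, rfl⟩
    obtain ⟨n, x, rfl⟩ := Module.DirectLimit.exists_of z
    rw [ExtColim.map_of, ExtColim.map_of, Ext.mk₀_comp_mk₀_assoc, w, Ext.mk₀_zero, Ext.zero_comp,
      map_zero]


/-- The part `colim Extⁱ(X₁, Y) → colim Extⁱ⁺¹(X₃, Y) → colim Extⁱ⁺¹(X₂, Y)` of the long exact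
sequence. The connecting maps are compatible with the transition maps by naturality of the
extension class. -/
lemma ExtColim.exists_exact_map (i : ℕ) :
    ∃ δ : ExtColim R X₁ Y i →ₗ[R] ExtColim R X₃ Y (i + 1),
      Function.Exact δ (ExtColim.map R β Y (i + 1)) := by
  refine ⟨Module.DirectLimit.map (fun n => (hS (op n)).extClass.precompOfLinear R Y (add_comm 1 i))
    (fun m n h => ?_), fun z => ⟨?_, ?_⟩⟩
  · ext x
    have := ShortComplex.ShortExact.extClass_naturality (hS (op n)) (hS (op m))
      { τ₁ := X₁.map (homOfLE h).op, τ₂ := X₂.map (homOfLE h).op, τ₃ := X₃.map (homOfLE h).op }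
    simp only [LinearMap.comp_apply, extColimTransition, Ext.bilinearCompOfLinear_apply_apply]
    rw [← Ext.comp_assoc _ _ _ (add_zero 1) (zero_add i) (by omega),
      ← Ext.comp_assoc _ _ _ (zero_add 1) (add_comm 1 i) (by omega)]
    exact congrArg (fun y => Ext.comp y x _) this
  · intro hz
    obtain ⟨n, x, rfl⟩ := Module.DirectLimit.exists_of z
    rw [ExtColim.map_of] at hz
    obtain ⟨m, hnm, hm⟩ := ExtColim.exists_transition_eq_zero hz
    rw [Ext.mk₀_comp_mk₀_assoc, β.naturality, ← Ext.mk₀_comp_mk₀_assoc] at hm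
    obtain ⟨y, hy⟩ := Ext.contravariant_sequence_exact₃ (hS (op m)) Y _ hm (add_comm 1 i)
    refine ⟨ExtColim.of R X₁ Y i m y, ?_⟩
    rw [Module.DirectLimit.map_apply_of]
    exact (congrArg _ hy).trans (ExtColim.of_transition X₃ Y (i + 1) hnm x)
  · rintro ⟨z, rfl⟩
    obtain ⟨n, x, rfl⟩ := Module.DirectLimit.exists_of z
    rw [Module.DirectLimit.map_apply_of, ExtColim.map_of]
    have : (Ext.mk₀ (β.app (op n))).comp ((hS (op n)).extClass.comp x (add_comm 1 i)) (zero_add _)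
        = 0 := (hS (op n)).comp_extClass_assoc x (add_comm 1 i)
    exact (congrArg _ this).trans (map_zero _)

end LongExact

/-- In degree `0` the functor is left exact. -/
lemma ExtColim.map_injective_of_epi {X X' : ℕᵒᵖ ⥤ 𝒞} (β : X ⟶ X') [∀ n, Epi (β.app n)] (Y : 𝒞) :
    Function.Injective (ExtColim.map R β Y 0) := by
  rw [injective_iff_map_eq_zero]
  intro z hz
  obtain ⟨n, x, rfl⟩ := Module.DirectLimit.exists_of z
  rw [ExtColim.map_of] at hz
  obtain ⟨m, hnm, hm⟩ := ExtColim.exists_transition_eq_zero hz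
  rw [Ext.mk₀_comp_mk₀_assoc, β.naturality, ← Ext.mk₀_comp_mk₀_assoc] at hm
  rw [← ExtColim.of_transition X' Y 0 hnm,
    Ext.precomp_mk₀_injective_of_epi Y (β.app (op m)) (hm.trans (map_zero _).symm), map_zero]

end ExtColim

/-! ### Generalized local cohomology in short exact sequences -/

section Filtration

open Opposite

variable {R : Type u} [CommRing R]

/-- The inverse system `n ↦ M / Fₙ` attached to a decreasing sequence of submodules of `M`. -/
def quotientSystem {M : Type u} [AddCommGroup M] [Module R M] (F : ℕ → Submodule R M)
    (hF : Antitone F) : ℕᵒᵖ ⥤ ModuleCat.{u} R where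
  obj n := ModuleCat.of R (M ⧸ F n.unop)
  map f := ModuleCat.ofHom (Submodule.factor (hF f.unop.le))
  map_id _ := by
    ext x
    rfl
  map_comp _ _ := by
    ext x
    rfl

/-- A linear map that respects two filtrations induces a morphism of inverse systems. -/
def quotientSystemMap {M N : Type u} [AddCommGroup M] [Module R M] [AddCommGroup N] [Module R N]
    {F : ℕ → Submodule R M} (hF : Antitone F) {G : ℕ → Submodule R N} (hG : Antitone G)
    (f : M →ₗ[R] N) (h : ∀ n, F n ≤ (G n).comap f) :
    quotientSystem F hF ⟶ quotientSystem G hG where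
  app n := ModuleCat.ofHom (Submodule.mapQ _ _ f (h n.unop))
  naturality _ _ _ := by
    ext x
    obtain ⟨x, rfl⟩ := Submodule.Quotient.mk_surjective _ x
    rfl

/-- Cofinal filtrations have the same `colim Ext`. -/
lemma ExtColim.map_bijective_of_cofinal {M : Type u} [AddCommGroup M] [Module R M]
    {F G : ℕ → Submodule R M} (hF : Antitone F) (hG : Antitone G) (h : ∀ n, F n ≤ G n)
    (h' : ∀ n, ∃ m ≥ n, G m ≤ F n) (Y : ModuleCat.{u} R) (i : ℕ) :
    Function.Bijective (ExtColim.map R (quotientSystemMap hF hG LinearMap.id h) Y i) := by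
  refine ExtColim.map_bijective _ Y i fun n => ?_
  obtain ⟨m, hm, hmn⟩ := h' n
  refine ⟨m, hm, ModuleCat.ofHom (Submodule.factor hmn), ?_, ?_⟩ <;>
  · ext x
    obtain ⟨x, rfl⟩ := Submodule.Quotient.mk_surjective _ x
    rfl

variable (a : Ideal R) (M : Type u) [AddCommGroup M] [Module R M]

lemma antitone_pow_smul_top : Antitone fun n : ℕ => (a ^ n • ⊤ : Submodule R M) :=
  fun _ _ h => Submodule.smul_mono_left (Ideal.pow_le_pow_right h)

/-- The inverse system `n ↦ M / aⁿM`. -/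
abbrev powSystem : ℕᵒᵖ ⥤ ModuleCat.{u} R :=
  quotientSystem (fun n : ℕ => (a ^ n • ⊤ : Submodule R M)) (antitone_pow_smul_top a M)

lemma finite_genLocalCohomology_iff (N : Type u) [AddCommGroup N] [Module R N] (i : ℕ) :
    Module.Finite R (genLocalCohomology a M N i) ↔
      Module.Finite R (ExtColim R (powSystem a M) (ModuleCat.of R N) i) := Iff.rfl

variable {M}

lemma map_pow_smul_top_of_surjective {N : Type u} [AddCommGroup N] [Module R N] {g : M →ₗ[R] N}
    (hg : Function.Surjective g) (n : ℕ) :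
    (a ^ n • ⊤ : Submodule R M).map g = a ^ n • ⊤ := by
  rw [Submodule.map_smul'', Submodule.map_top, LinearMap.range_eq_top.2 hg]

/-- The Artin-Rees lemma: the filtration that the `a`-adic one on `M` induces on a submodule `L`
is cofinal with the `a`-adic filtration of `L`. -/
lemma exists_comap_pow_smul_top_le [IsNoetherianRing R] [Module.Finite R M] {L : Type u}
    [AddCommGroup L] [Module R L] {f : L →ₗ[R] M} (hf : Function.Injective f) (n : ℕ) :
    ∃ m ≥ n, (a ^ m • ⊤ : Submodule R M).comap f ≤ a ^ n • ⊤ := by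
  obtain ⟨k, hk⟩ := Ideal.exists_pow_inf_eq_pow_smul a (LinearMap.range f)
  refine ⟨n + k, Nat.le_add_right n k, fun x hx => ?_⟩
  have h1 : f x ∈ a ^ (n + k) • ⊤ ⊓ LinearMap.range f := ⟨hx, x, rfl⟩
  rw [hk (n + k) (Nat.le_add_left k n), Nat.add_sub_cancel] at h1
  have h2 : f x ∈ (a ^ n • ⊤ : Submodule R L).map f := by
    rw [Submodule.map_smul'', Submodule.map_top]
    exact Submodule.smul_mono le_rfl inf_le_right h1
  obtain ⟨y, hy, hxy⟩ := h2
  exact hf hxy ▸ hy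

end Filtration

lemma Module.Finite.of_exact_of_isNoetherianRing {R A B D : Type*} [CommRing R] [IsNoetherianRing R]
    [AddCommGroup A] [Module R A] [AddCommGroup B] [Module R B] [AddCommGroup D] [Module R D]
    {f : A →ₗ[R] B} {g : B →ₗ[R] D} [Module.Finite R A] [Module.Finite R D]
    (h : Function.Exact f g) : Module.Finite R B :=
  have := isNoetherian_of_range_eq_ker f g h.linearMap_ker_eq.symm
  inferInstance

section LongExact

variable {R : Type u} [CommRing R] [IsNoetherianRing R] (a : Ideal R)
  {L M N : Type u} [AddCommGroup L] [Module R L]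
  [AddCommGroup M] [Module R M] [Module.Finite R M] [AddCommGroup N] [Module R N]
  {f : L →ₗ[R] M} {g : M →ₗ[R] N} (hf : Function.Injective f) (hfg : Function.Exact f g)
  (hg : Function.Surjective g) (C : Type u) [AddCommGroup C] [Module R C]

include hf hfg hg

/-- A short exact sequence `0 → L → M → N → 0` gives short exact sequences
`0 → L / (L ∩ aⁿM) → M / aⁿM → N / aⁿN → 0`, compatible with the projections, and the left-hand
system has the same `colim Ext` as `L / aⁿL`. -/
lemma exists_shortExact_powSystem :
    ∃ (X : ℕᵒᵖ ⥤ ModuleCat.{u} R) (α : X ⟶ powSystem a M) (β : powSystem a M ⟶ powSystem a N)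
      (w : ∀ n, α.app n ≫ β.app n = 0), (∀ n, (ShortComplex.mk _ _ (w n)).ShortExact) ∧
      ∃ θ : powSystem a L ⟶ X, ∀ (Y : ModuleCat.{u} R) (i : ℕ),
        Function.Bijective (ExtColim.map R θ Y i) := by
  have hG : Antitone fun n : ℕ => (a ^ n • ⊤ : Submodule R M).comap f :=
    fun _ _ h => Submodule.comap_mono (antitone_pow_smul_top a M h)
  have hgn (n : ℕ) : (a ^ n • ⊤ : Submodule R M) ≤ (a ^ n • ⊤ : Submodule R N).comap g :=
    Submodule.map_le_iff_le_comap.1 (map_pow_smul_top_of_surjective a hg n).le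
  have hfn (n : ℕ) : (a ^ n • ⊤ : Submodule R L) ≤ (a ^ n • ⊤ : Submodule R M).comap f := by
    rw [← Submodule.map_le_iff_le_comap, Submodule.map_smul'']
    exact Submodule.smul_mono le_rfl le_top
  refine ⟨quotientSystem _ hG, quotientSystemMap hG (antitone_pow_smul_top a M) f fun _ => le_rfl,
    quotientSystemMap (antitone_pow_smul_top a M) (antitone_pow_smul_top a N) g hgn, fun n => ?_,
    fun n => ?_, quotientSystemMap (antitone_pow_smul_top a L) hG LinearMap.id hfn, fun Y i =>
      ExtColim.map_bijective_of_cofinal _ _ hfn (exists_comap_pow_smul_top_le a hf) Y i⟩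
  · ext x
    obtain ⟨x, rfl⟩ := Submodule.Quotient.mk_surjective _ x
    change Submodule.Quotient.mk (g (f x)) = 0
    rw [hfg.apply_apply_eq_zero, Submodule.Quotient.mk_zero]
  · refine ShortComplex.ShortExact.mk' ?_ ?_ ?_
    · rw [ShortComplex.moduleCat_exact_iff]
      intro x hx
      obtain ⟨x, rfl⟩ := Submodule.Quotient.mk_surjective _ x
      have hx' : (Submodule.Quotient.mk (g x) : N ⧸ (a ^ n.unop • ⊤ : Submodule R N)) = 0 := hx
      rw [Submodule.Quotient.mk_eq_zero, ← map_pow_smul_top_of_surjective a hg] at hx'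
      obtain ⟨y, hy, hyx⟩ := hx'
      obtain ⟨z, hz⟩ := (hfg (x - y)).1 (by rw [map_sub, hyx, sub_self])
      refine ⟨Submodule.Quotient.mk z, ?_⟩
      change (Submodule.Quotient.mk (f z) : M ⧸ (a ^ n.unop • ⊤ : Submodule R M)) =
        Submodule.Quotient.mk x
      rw [Submodule.Quotient.eq, hz, sub_sub_cancel_left]
      exact neg_mem hy
    · rw [ModuleCat.mono_iff_injective, injective_iff_map_eq_zero]
      intro x hx
      obtain ⟨x, rfl⟩ := Submodule.Quotient.mk_surjective _ x
      have hx' : (Submodule.Quotient.mk (f x) : M ⧸ (a ^ n.unop • ⊤ : Submodule R M)) = 0 := hx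
      rw [Submodule.Quotient.mk_eq_zero] at hx'
      exact (Submodule.Quotient.mk_eq_zero _).2 hx'
    · rw [ModuleCat.epi_iff_surjective]
      intro x
      obtain ⟨x, rfl⟩ := Submodule.Quotient.mk_surjective _ x
      obtain ⟨y, rfl⟩ := hg x
      exact ⟨Submodule.Quotient.mk y, rfl⟩

/-- For `0 → L → M → N → 0` exact, the module `Hⁱ_a(M, C)` is an extension of a submodule of
`Hⁱ_a(L, C)` by a quotient of `Hⁱ_a(N, C)`. -/
lemma finite_genLocalCohomology_of_exact (i : ℕ)
    (hL : Module.Finite R (genLocalCohomology a L C i))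
    (hN : Module.Finite R (genLocalCohomology a N C i)) :
    Module.Finite R (genLocalCohomology a M C i) := by
  obtain ⟨X, α, β, w, hS, θ, hθ⟩ := exists_shortExact_powSystem a hf hfg hg
  rw [finite_genLocalCohomology_iff] at hL hN ⊢
  have := Module.Finite.of_injective _ (hθ (ModuleCat.of R C) i).1
  have hex := ExtColim.exact_map_map (R := R) α β w hS (ModuleCat.of R C) i
  exact Module.Finite.of_exact_of_isNoetherianRing hex

/-- For `0 → L → M → N → 0` exact, the module `Hⁱ⁺¹_a(N, C)` is an extension of a submodule of
`Hⁱ⁺¹_a(M, C)` by a quotient of `Hⁱ_a(L, C)`. -/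
lemma finite_genLocalCohomology_succ_right (i : ℕ)
    (hL : Module.Finite R (genLocalCohomology a L C i))
    (hM : Module.Finite R (genLocalCohomology a M C (i + 1))) :
    Module.Finite R (genLocalCohomology a N C (i + 1)) := by
  obtain ⟨X, α, β, w, hS, θ, hθ⟩ := exists_shortExact_powSystem a hf hfg hg
  rw [finite_genLocalCohomology_iff] at hL hM ⊢
  have := Module.Finite.of_injective _ (hθ (ModuleCat.of R C) i).1
  obtain ⟨δ, hδ⟩ := ExtColim.exists_exact_map (R := R) α β w hS (ModuleCat.of R C) i
  exact Module.Finite.of_exact_of_isNoetherianRing hδ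

omit hfg hf in
/-- For `M → N` surjective, `H⁰_a(N, C)` is a submodule of `H⁰_a(M, C)`. -/
lemma finite_genLocalCohomology_zero_right (hM : Module.Finite R (genLocalCohomology a M C 0)) :
    Module.Finite R (genLocalCohomology a N C 0) := by
  obtain ⟨X, α, β, w, hS, -⟩ := exists_shortExact_powSystem a
    (LinearMap.ker g).injective_subtype (LinearMap.exact_subtype_ker_map g) hg
  rw [finite_genLocalCohomology_iff] at hM ⊢
  have (n : ℕᵒᵖ) : Epi (β.app n) := (hS n).epi_g
  exact Module.Finite.of_injective _ (ExtColim.map_injective_of_epi (R := R) β (ModuleCat.of R C))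

end LongExact

section Torsion

variable {R : Type u} [CommRing R] [IsNoetherianRing R] (a : Ideal R)

/-- If `a ^ k` kills `M`, the system `M / aⁿM` is constant from `k` on, so `Hⁱ_a(M, C)` is a
quotient of the finitely generated module `Extⁱ(M / aᵏM, C)`. -/
lemma finite_genLocalCohomology_of_pow_smul_eq_bot (M C : Type u) [AddCommGroup M] [Module R M]
    [Module.Finite R M] [AddCommGroup C] [Module R C] [Module.Finite R C] {k : ℕ}
    (h : (a ^ k • ⊤ : Submodule R M) = ⊥) (i : ℕ) :
    Module.Finite R (genLocalCohomology a M C i) := by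
  rw [finite_genLocalCohomology_iff]
  have hfin : Module.Finite R ((powSystem a M).obj (Opposite.op k)) :=
    inferInstanceAs (Module.Finite R (M ⧸ (a ^ k • ⊤ : Submodule R M)))
  refine Module.Finite.of_surjective _ (ExtColim.of_surjective (R := R) (powSystem a M)
    (ModuleCat.of R C) i k fun n hn => ?_)
  rw [ConcreteCategory.isIso_iff_bijective]
  refine ⟨?_, ?_⟩
  · rw [injective_iff_map_eq_zero]
    intro x hx
    obtain ⟨x, rfl⟩ := Submodule.Quotient.mk_surjective _ x
    have hx' : (Submodule.Quotient.mk x : M ⧸ (a ^ k • ⊤ : Submodule R M)) = 0 := hx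
    rw [Submodule.Quotient.mk_eq_zero, h, Submodule.mem_bot] at hx'
    rw [hx']
    rfl
  · intro x
    obtain ⟨x, rfl⟩ := Submodule.Quotient.mk_surjective _ x
    exact ⟨Submodule.Quotient.mk x, rfl⟩

end Torsion

/-! ### Comparison of the two models of `Ext` -/

namespace CochainComplex

universe v r

variable {R : Type r} [Ring R]

/-- The class in cohomology of a cocycle of a cochain complex of modules. -/
def cocycleClass (K : CochainComplex (ModuleCat.{v} R) ℕ) (n : ℕ) :
    LinearMap.ker (K.d n (n + 1)).hom →ₗ[R] K.homology n :=
  (K.liftCycles (ModuleCat.ofHom (LinearMap.ker (K.d n (n + 1)).hom).subtype) (n + 1) (by simp)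
    (by ext x; exact x.2) ≫ K.homologyπ n).hom

lemma cocycleClass_surjective (K : CochainComplex (ModuleCat.{v} R) ℕ) (n : ℕ) :
    Function.Surjective (K.cocycleClass n) := by
  intro y
  obtain ⟨z, rfl⟩ := (ModuleCat.epi_iff_surjective (K.homologyπ n)).1 inferInstance y
  have hz : K.iCycles n z ∈ LinearMap.ker (K.d n (n + 1)).hom := by
    change (K.iCycles n ≫ K.d n (n + 1)) z = 0
    rw [K.iCycles_d]
    rfl
  refine ⟨⟨_, hz⟩, ?_⟩
  change K.homologyπ n (K.liftCycles _ (n + 1) _ _ _) = _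
  congr 1
  apply (ModuleCat.mono_iff_injective (K.iCycles n)).1 inferInstance
  rw [← ModuleCat.comp_apply, K.liftCycles_i]
  rfl

/-- A cocycle has trivial class if and only if it is a coboundary. In degree `0`, where `prev 0 = 0`
and `d 0 0 = 0`, this says that the cocycle vanishes. -/
lemma cocycleClass_eq_zero_iff (K : CochainComplex (ModuleCat.{v} R) ℕ) (n : ℕ)
    (x : LinearMap.ker (K.d n (n + 1)).hom) :
    K.cocycleClass n x = 0 ↔ ∃ y, K.d ((ComplexShape.up ℕ).prev n) n y = x := by
  have hex := ShortComplex.exact_of_g_is_cokernel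
    (ShortComplex.mk _ _ (K.toCycles_comp_homologyπ ((ComplexShape.up ℕ).prev n) n))
    (K.homologyIsCokernel _ n rfl)
  rw [ShortComplex.moduleCat_exact_iff] at hex
  set z := K.liftCycles (ModuleCat.ofHom (LinearMap.ker (K.d n (n + 1)).hom).subtype) (n + 1)
    (by simp) (by ext x; exact x.2) x with hzdef
  have hz : K.iCycles n z = x := by
    rw [hzdef, ← ModuleCat.comp_apply, K.liftCycles_i]
    rfl
  constructor
  · intro h
    obtain ⟨y, hy⟩ := hex z h
    refine ⟨y, ?_⟩
    rw [← hz, ← hy, ← K.toCycles_i, ModuleCat.comp_apply]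
  · rintro ⟨y, hy⟩
    have : K.toCycles _ n y = z := by
      apply (ModuleCat.mono_iff_injective (K.iCycles n)).1 inferInstance
      rw [hz, ← hy, ← ModuleCat.comp_apply, K.toCycles_i]
    change K.homologyπ n z = 0
    rw [← this, ← ModuleCat.comp_apply, K.toCycles_comp_homologyπ]
    rfl

lemma homologyMap_cocycleClass {K K' : CochainComplex (ModuleCat.{v} R) ℕ} (ψ : K ⟶ K') (n : ℕ)
    (x : LinearMap.ker (K.d n (n + 1)).hom) (y : LinearMap.ker (K'.d n (n + 1)).hom)
    (h : ψ.f n x = y) :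
    HomologicalComplex.homologyMap ψ n (K.cocycleClass n x) = K'.cocycleClass n y := by
  change (K.homologyπ n ≫ HomologicalComplex.homologyMap ψ n) (K.liftCycles
      (ModuleCat.ofHom (LinearMap.ker (K.d n (n + 1)).hom).subtype) (n + 1) _ _ x) =
    K'.homologyπ n (K'.liftCycles (ModuleCat.ofHom (LinearMap.ker (K'.d n (n + 1)).hom).subtype)
      (n + 1) _ _ y)
  rw [HomologicalComplex.homologyπ_naturality, ModuleCat.comp_apply]
  congr 1
  apply (ModuleCat.mono_iff_injective (K'.iCycles n)).1 inferInstance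
  rw [← ModuleCat.comp_apply, HomologicalComplex.cyclesMap_i, ← ModuleCat.comp_apply,
    HomologicalComplex.liftCycles_i_assoc, ← ModuleCat.comp_apply, HomologicalComplex.liftCycles_i]
  exact h

end CochainComplex

namespace CategoryTheory.ProjectiveResolution

universe w v' u' r

variable {R : Type r} [CommRing R] {𝒞 : Type u'} [Category.{v'} 𝒞] [Abelian 𝒞] [Linear R 𝒞]

section

variable [EnoughProjectives 𝒞]

/-- The map of `Hom` complexes induced by a map of chain complexes. -/
def linearYonedaMap {P Q : ChainComplex 𝒞 ℕ} (φ : P ⟶ Q) (Y : 𝒞) :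
    Q.linearYonedaObj R Y ⟶ P.linearYonedaObj R Y :=
  (HomologicalComplex.unopFunctor _ _).map
    (((((linearYoneda R 𝒞).obj Y).rightOp.mapHomologicalComplex _).map φ).op)

/-- The isomorphism `ProjectiveResolution.isoExt` is natural in the first variable. -/
lemma isoExt_hom_naturality {X X' : 𝒞} (g : X' ⟶ X) (P' : ProjectiveResolution X')
    (P : ProjectiveResolution X) (φ : P'.complex ⟶ P.complex)
    (comm : φ.f 0 ≫ P.π.f 0 = P'.π.f 0 ≫ g) (n : ℕ) (Y : 𝒞) :
    ((_root_.Ext R 𝒞 n).map g.op).app Y ≫ (P'.isoExt n Y).hom =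
      (P.isoExt n Y).hom ≫ HomologicalComplex.homologyMap (linearYonedaMap φ Y) n := by
  -- `isoExt` unfolds to arrows of the opposite category, for which both squares are known.
  have h1 := isoLeftDerivedObj_inv_naturality g P' P φ comm ((linearYoneda R 𝒞).obj Y).rightOp n
  have h2 := HomologicalComplex.homologyOp_hom_naturality (linearYonedaMap (R := R) φ Y) n
  have h3 := (Iso.inv_comp_eq _).2 (((Iso.eq_comp_inv _).2 h2).trans (Category.assoc _ _ _))
  have key {A B D E F G : (ModuleCat R)ᵒᵖ} {a : A ⟶ B} {b : B ⟶ D} {c : D ⟶ E} {d : B ⟶ F}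
      {e : F ⟶ E} {f : A ⟶ G} {g : G ⟶ F} (h : b ≫ c = d ≫ e) (h' : a ≫ d = f ≫ g) :
      a ≫ b ≫ c = f ≫ g ≫ e := by
    rw [h, reassoc_of% h']
  apply Quiver.Hom.op_inj
  change ((P'.complex.linearYonedaObj R Y).homologyOp n).inv ≫
      (P'.isoLeftDerivedObj ((linearYoneda R 𝒞).obj Y).rightOp n).inv ≫
      (((linearYoneda R 𝒞).obj Y).rightOp.leftDerived n).map g =
    (HomologicalComplex.homologyMap (linearYonedaMap φ Y) n).op ≫
      ((P.complex.linearYonedaObj R Y).homologyOp n).inv ≫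
      (P.isoLeftDerivedObj ((linearYoneda R 𝒞).obj Y).rightOp n).inv
  exact key h1 h3

end

section

variable [HasExt.{w} 𝒞]

/-- A version of `extMk_eq_zero_iff` that includes degree `0`, where `prev 0 = 0` and
`d 0 0 = 0`. -/
lemma extMk_eq_zero_iff_exists {X Y : 𝒞} (P : ProjectiveResolution X) {n : ℕ}
    (f : P.complex.X n ⟶ Y) (hf : P.complex.d (n + 1) n ≫ f = 0) :
    P.extMk f (n + 1) rfl hf = 0 ↔
      ∃ g : P.complex.X ((ComplexShape.up ℕ).prev n) ⟶ Y, P.complex.d n _ ≫ g = f := by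
  cases n with
  | succ p =>
    rw [P.extMk_eq_zero_iff f (p + 2) rfl hf p rfl]
    have : (ComplexShape.up ℕ).prev (p + 1) = p := by simp
    rw [this]
  | zero =>
    rw [← P.extEquivCohomologyClass.apply_eq_iff_eq, extEquivCohomologyClass_extMk,
      extEquivCohomologyClass_zero, CochainComplex.HomComplex.CohomologyClass.mk_eq_zero_iff,
      CochainComplex.HomComplex.Cocycle.toSingleMk_mem_coboundaries_iff _ _ _ _ _ 1 (by simp)]
    -- The extension of `P` to `ℤ` vanishes in degree `1`, so there are no coboundaries.
    have h0 : P.cochainComplex.d (-(0 : ℕ)) 1 = 0 :=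
      (CochainComplex.isZero_of_isStrictlyLE P.cochainComplex 0 1).eq_of_tgt _ _
    have h1 : P.complex.d 0 ((ComplexShape.up ℕ).prev 0) = 0 := P.complex.shape _ _ (by simp)
    rw [h0, h1]
    simp only [Limits.zero_comp, exists_const]
    rw [eq_comm, eq_comm (a := 0), Preadditive.IsIso.comp_left_eq_zero]

lemma smul_extMk {X Y : 𝒞} (P : ProjectiveResolution X) {n : ℕ} (r : R)
    (f : P.complex.X n ⟶ Y) (m : ℕ) (hm : n + 1 = m) (hf : P.complex.d m n ≫ f = 0) :
    r • P.extMk f m hm hf = P.extMk (r • f) m hm (by simp [hf]) := by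
  rw [Ext.smul_eq_comp_mk₀, extMk_comp_mk₀]
  congr 1
  simp

/-- The class in `Extⁿ(X, Y)` of a cocycle of `Hom(P, Y)`, as a linear map. -/
def extMkLinear {X : 𝒞} (P : ProjectiveResolution X) (Y : 𝒞) (n : ℕ) :
    LinearMap.ker ((P.complex.linearYonedaObj R Y).d n (n + 1)).hom →ₗ[R] Abelian.Ext X Y n where
  toFun f := P.extMk (n := n) f.1 (n + 1) rfl f.2
  map_add' _ _ := (P.add_extMk _ _ _ _ _ _).symm
  map_smul' r _ := (P.smul_extMk r _ _ _ _).symm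

lemma extMkLinear_surjective {X : 𝒞} (P : ProjectiveResolution X) (Y : 𝒞) (n : ℕ) :
    Function.Surjective (P.extMkLinear (R := R) Y n) := fun x => by
  obtain ⟨f, hf, rfl⟩ := P.extMk_surjective x (n + 1) rfl
  exact ⟨⟨f, hf⟩, rfl⟩

lemma ker_extMkLinear {X : 𝒞} (P : ProjectiveResolution X) (Y : 𝒞) (n : ℕ) :
    LinearMap.ker (P.extMkLinear (R := R) Y n) =
      LinearMap.ker ((P.complex.linearYonedaObj R Y).cocycleClass n) := by
  ext f
  rw [LinearMap.mem_ker, LinearMap.mem_ker, CochainComplex.cocycleClass_eq_zero_iff]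
  exact P.extMk_eq_zero_iff_exists _ f.2

/-- `Extⁿ(X, Y)`, computed in the derived category, is the `n`-th cohomology of `Hom(P, Y)` for a
projective resolution `P` of `X`. -/
def extLinearEquivHomology {X : 𝒞} (P : ProjectiveResolution X) (Y : 𝒞) (n : ℕ) :
    Abelian.Ext X Y n ≃ₗ[R] (P.complex.linearYonedaObj R Y).homology n :=
  ((P.extMkLinear Y n).quotKerEquivOfSurjective (P.extMkLinear_surjective Y n)).symm ≪≫ₗ
    Submodule.quotEquivOfEq _ _ (P.ker_extMkLinear Y n) ≪≫ₗ
    LinearMap.quotKerEquivOfSurjective _ (CochainComplex.cocycleClass_surjective _ n)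

lemma extLinearEquivHomology_extMkLinear {X : 𝒞} (P : ProjectiveResolution X) (Y : 𝒞) (n : ℕ)
    (f : LinearMap.ker ((P.complex.linearYonedaObj R Y).d n (n + 1)).hom) :
    P.extLinearEquivHomology Y n (P.extMkLinear Y n f) =
      (P.complex.linearYonedaObj R Y).cocycleClass n f := by
  have : ((P.extMkLinear Y n).quotKerEquivOfSurjective (P.extMkLinear_surjective Y n)).symm
      (P.extMkLinear Y n f) = Submodule.Quotient.mk f := by
    rw [LinearEquiv.symm_apply_eq]
    rfl
  rw [extLinearEquivHomology, LinearEquiv.trans_apply, LinearEquiv.trans_apply, this]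
  rfl

end

variable [HasExt.{w} 𝒞] [EnoughProjectives 𝒞]

/-- The comparison of `Abelian.Ext` with the derived functors of `Hom(-, Y)`. -/
def extLinearEquiv (X Y : 𝒞) (n : ℕ) :
    Abelian.Ext X Y n ≃ₗ[R] ((_root_.Ext R 𝒞 n).obj (Opposite.op X)).obj Y :=
  (projectiveResolution X).extLinearEquivHomology Y n ≪≫ₗ
    ((projectiveResolution X).isoExt n Y).symm.toLinearEquiv

/-- Naturality of the comparison in the first variable; on cocycles of `Hom(P, Y)` both sides are
composition with a lift of `g` to projective resolutions. -/
lemma extLinearEquiv_naturality {X X' : 𝒞} (g : X' ⟶ X) (Y : 𝒞) (n : ℕ) (x : Abelian.Ext X Y n) :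
    extLinearEquiv (R := R) X' Y n ((Ext.mk₀ g).comp x (zero_add n)) =
      (((_root_.Ext R 𝒞 n).map g.op).app Y) (extLinearEquiv X Y n x) := by
  obtain ⟨f, rfl⟩ := (projectiveResolution X).extMkLinear_surjective (R := R) Y n x
  let φ : Hom (projectiveResolution X') (projectiveResolution X) g :=
    { hom := lift g _ _
      hom_f_zero_comp_π_f_zero := (lift_commutes_zero g _ _).trans (by simp) }
  let f₀ : (projectiveResolution X).complex.X n ⟶ Y := f.1
  have hf : (projectiveResolution X).complex.d (n + 1) n ≫ f₀ = 0 := f.2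
  have hf' : (projectiveResolution X').complex.d (n + 1) n ≫ φ.hom.f n ≫ f₀ = 0 := by
    rw [← φ.hom.comm_assoc, hf, Limits.comp_zero]
  let f' : LinearMap.ker (((projectiveResolution X').complex.linearYonedaObj R Y).d n (n + 1)).hom :=
    ⟨φ.hom.f n ≫ f₀, hf'⟩
  have h1 : (Ext.mk₀ g).comp ((projectiveResolution X).extMkLinear (R := R) Y n f) (zero_add n) =
      (projectiveResolution X').extMkLinear Y n f' :=
    mk₀_comp_extMk (R := projectiveResolution X) f₀ (n + 1) rfl hf φ
  have h2 := isoExt_hom_naturality (R := R) g _ (projectiveResolution X) φ.hom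
    (lift_commutes_zero g _ _) n Y
  apply (((projectiveResolution X').isoExt n Y).toLinearEquiv).injective
  have h3 : ((projectiveResolution X).isoExt n Y).hom
      (extLinearEquiv (R := R) X Y n ((projectiveResolution X).extMkLinear Y n f)) =
      (projectiveResolution X).extLinearEquivHomology Y n
        ((projectiveResolution X).extMkLinear (R := R) Y n f) :=
    ((projectiveResolution X).isoExt n Y).toLinearEquiv.apply_symm_apply _
  rw [h1]
  refine (((projectiveResolution X').isoExt n Y).toLinearEquiv.apply_symm_apply _).trans ?_
  refine Eq.trans ?_ (ConcreteCategory.congr_hom h2 _).symm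
  refine (extLinearEquivHomology_extMkLinear _ Y n f').trans ?_
  rw [ModuleCat.comp_apply, h3, extLinearEquivHomology_extMkLinear]
  exact (CochainComplex.homologyMap_cocycleClass _ n _ _ rfl).symm

end CategoryTheory.ProjectiveResolution

/-! ### Local cohomology as generalized local cohomology -/

section LocalCohomology

open Opposite

variable {R : Type u} [CommRing R] (a : Ideal R) (M : Type u) [AddCommGroup M] [Module R M] (i : ℕ)

/-- The isomorphism `R / aⁿR ≅ R / aⁿ` of the two models of the `n`-th quotient. -/
def powSystemIso (n : ℕ) :
    (localCohomology.ringModIdeals (localCohomology.idealPowersDiagram a)).obj (op n) ≅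
      (powSystem a R).obj (op n) :=
  (Submodule.quotEquivOfEq (a ^ n) (a ^ n • ⊤ : Submodule R R) (by simp)).toModuleIso

lemma powSystemIso_naturality {m n : ℕ} (h : m ≤ n) :
    (localCohomology.ringModIdeals (localCohomology.idealPowersDiagram a)).map (homOfLE h).op ≫
      (powSystemIso a m).hom = (powSystemIso a n).hom ≫ (powSystem a R).map (homOfLE h).op := by
  ext x
  obtain ⟨x, rfl⟩ := Submodule.Quotient.mk_surjective _ x
  rfl

/-- The terms of the two direct systems that define `Hⁱ_a(R, M)` and `Hⁱ_a(M)` agree. -/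
def extPowEquiv (n : ℕ) :
    Ext ((powSystem a R).obj (op n)) (ModuleCat.of R M) i ≃ₗ[R]
      ((localCohomology.diagram (localCohomology.idealPowersDiagram a) i).obj (op (op n))).obj
        (ModuleCat.of R M) :=
  LinearEquiv.ofBijective ((Ext.mk₀ (powSystemIso a n).hom).precompOfLinear R _ (zero_add i))
    (Function.bijective_iff_has_inverse.2
      ⟨fun x => (Ext.mk₀ (powSystemIso a n).inv).comp x (zero_add i), fun x => by simp,
        fun x => by simp⟩) ≪≫ₗ
  ProjectiveResolution.extLinearEquiv _ _ i

lemma extPowEquiv_transition {m n : ℕ} (h : m ≤ n)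
    (x : Ext ((powSystem a R).obj (op m)) (ModuleCat.of R M) i) :
    extPowEquiv a M i n ((Ext.mk₀ ((powSystem a R).map (homOfLE h).op)).comp x (zero_add i)) =
      ((localCohomology.diagram (localCohomology.idealPowersDiagram a) i).map
        (homOfLE h).op.op).app (ModuleCat.of R M) (extPowEquiv a M i m x) := by
  refine Eq.trans ?_ (ProjectiveResolution.extLinearEquiv_naturality
    ((localCohomology.ringModIdeals (localCohomology.idealPowersDiagram a)).map (homOfLE h).op)
    (ModuleCat.of R M) i ((Ext.mk₀ (powSystemIso a m).hom).comp x (zero_add i)))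
  rw [Ext.mk₀_comp_mk₀_assoc, powSystemIso_naturality, ← Ext.mk₀_comp_mk₀_assoc]
  rfl

/-- Local cohomology `Hⁱ_a(M)` is the generalized local cohomology `Hⁱ_a(R, M)`. -/
lemma nonempty_genLocalCohomology_equiv_localCohomology :
    Nonempty (genLocalCohomology a R M i ≃ₗ[R]
      (localCohomology a i).obj (ModuleCat.of R M)) := by
  let D := localCohomology.diagram (localCohomology.idealPowersDiagram a) i
  let c := ((evaluation _ _).obj (ModuleCat.of R M)).mapCocone (Limits.colimit.cocone D)
  have hc : Limits.IsColimit c := Limits.isColimitOfPreserves _ (Limits.colimit.isColimit D)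
  let fwd : ExtColim R (powSystem a R) (ModuleCat.of R M) i →ₗ[R] c.pt :=
    Module.DirectLimit.lift R ℕ _ _
      (fun n => (c.ι.app (op (op n))).hom ∘ₗ (extPowEquiv a M i n).toLinearMap)
      fun m n h x => by
        have := ConcreteCategory.congr_hom (c.w (homOfLE h).op.op) (extPowEquiv a M i m x)
        refine Eq.trans ?_ this
        exact congrArg (c.ι.app (op (op n))) (extPowEquiv_transition a M i h x)
  let s : Limits.Cocone (D ⋙ (evaluation _ _).obj (ModuleCat.of R M)) :=
    { pt := ModuleCat.of R (ExtColim R (powSystem a R) (ModuleCat.of R M) i)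
      ι :=
        { app n := ModuleCat.ofHom (ExtColim.of R _ _ i n.unop.unop ∘ₗ
            (extPowEquiv a M i n.unop.unop).symm.toLinearMap)
          naturality m n h := by
            ext y
            obtain ⟨x, rfl⟩ := (extPowEquiv a M i m.unop.unop).surjective y
            have hmn : m.unop.unop ≤ n.unop.unop := h.unop.unop.le
            have h1 := extPowEquiv_transition a M i hmn x
            have h2 := ExtColim.of_transition (R := R) (powSystem a R) (ModuleCat.of R M) i hmn x
            change ExtColim.of R _ _ i n.unop.unop ((extPowEquiv a M i n.unop.unop).symm
              ((D.map h).app (ModuleCat.of R M) (extPowEquiv a M i m.unop.unop x))) =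
              ExtColim.of R _ _ i m.unop.unop ((extPowEquiv a M i m.unop.unop).symm
                (extPowEquiv a M i m.unop.unop x))
            rw [LinearEquiv.symm_apply_apply, ← h2]
            exact congrArg _ ((LinearEquiv.symm_apply_eq _).2 h1.symm) } }
  have hs (n : ℕ) (x : Ext ((powSystem a R).obj (op n)) (ModuleCat.of R M) i) :
      hc.desc s (c.ι.app (op (op n)) (extPowEquiv a M i n x)) = ExtColim.of R _ _ i n x := by
    refine (ConcreteCategory.congr_hom (hc.fac s (op (op n))) _).trans ?_
    exact congrArg (ExtColim.of R _ _ i n) ((extPowEquiv a M i n).symm_apply_apply x)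
  have hto (n : ℕ) (x : Ext ((powSystem a R).obj (op n)) (ModuleCat.of R M) i) :
      fwd (ExtColim.of R _ _ i n x) = c.ι.app (op (op n)) (extPowEquiv a M i n x) :=
    Module.DirectLimit.lift_of _ _ _
  refine ⟨LinearEquiv.ofLinearMap fwd (hc.desc s).hom ?_ ?_⟩
  · have : hc.desc s ≫ ModuleCat.ofHom fwd = 𝟙 _ := by
      refine hc.hom_ext fun n => ?_
      ext y
      obtain ⟨x, rfl⟩ := (extPowEquiv a M i n.unop.unop).surjective y
      exact (congrArg fwd (hs n.unop.unop x)).trans (hto _ x)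
    exact congrArg ModuleCat.Hom.hom this
  · ext n x
    exact (congrArg (hc.desc s) (hto n x)).trans (hs n x)

end LocalCohomology

/-! ### Dependence of the finiteness dimension on the support -/

section Support

variable {R : Type u} [CommRing R]

open TensorProduct in
/-- A finitely generated module maps nontrivially to `R / p` for every prime `p` of its support:
by Nakayama's lemma it has a nonzero functional with values in the residue field of `p`, whose
denominators can be cleared. -/
lemma exists_ne_zero_of_mem_support {M : Type u} [AddCommGroup M] [Module R M] [Module.Finite R M]
    {p : PrimeSpectrum R} (hp : p ∈ Module.support R M) :
    ∃ φ : M →ₗ[R] R ⧸ p.asIdeal, φ ≠ 0 := by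
  let K := p.asIdeal.ResidueField
  have := (Module.mem_support_iff_nontrivial_residueField_tensorProduct p).1 hp
  obtain ⟨ψ, hψ⟩ : ∃ ψ : M →ₗ[R] K, ψ ≠ 0 := by
    obtain ⟨v, hv⟩ := exists_ne (0 : K ⊗[R] M)
    obtain ⟨g, hg⟩ := not_forall.1 (mt (Module.forall_dual_apply_eq_zero_iff K v).1 hv)
    refine ⟨g.restrictScalars R ∘ₗ TensorProduct.mk R K M 1, fun h => hg ?_⟩
    have hz (w : K ⊗[R] M) : g w = 0 := by
      induction w with
      | zero => exact map_zero g
      | add x y hx hy => rw [map_add, hx, hy, add_zero]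
      | tmul c m =>
        have hm : g (1 ⊗ₜ[R] m) = 0 := LinearMap.congr_fun h m
        rw [← mul_one c, ← smul_eq_mul, ← TensorProduct.smul_tmul', map_smul, hm, smul_zero]
    exact hz v
  obtain ⟨s, hs⟩ := Module.Finite.fg_top (R := R) (M := M)
  obtain ⟨d, hd⟩ := IsLocalization.exist_integer_multiples (nonZeroDivisors (R ⧸ p.asIdeal)) s ψ
  let ι : (R ⧸ p.asIdeal) →ₗ[R] K := (IsScalarTower.toAlgHom R (R ⧸ p.asIdeal) K).toLinearMap
  have hι : Function.Injective ι := p.asIdeal.injective_algebraMap_quotient_residueField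
  let ψ' : M →ₗ[R] K := LinearMap.mulLeft R (algebraMap (R ⧸ p.asIdeal) K d) ∘ₗ ψ
  have hψ' (x : M) : ψ' x ∈ LinearMap.range ι := by
    have : (⊤ : Submodule R M) ≤ (LinearMap.range ι).comap ψ' := by
      rw [← hs, Submodule.span_le]
      intro x hx
      obtain ⟨y, hy⟩ := hd x hx
      exact ⟨y, hy.trans (Algebra.smul_def _ _)⟩
    exact this trivial
  refine ⟨(LinearEquiv.ofInjective ι hι).symm.toLinearMap ∘ₗ ψ'.codRestrict _ hψ', fun h => hψ ?_⟩
  ext x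
  have hx : ψ' x = 0 := by
    have h1 : (LinearEquiv.ofInjective ι hι).symm ⟨ψ' x, hψ' x⟩ = 0 := LinearMap.congr_fun h x
    rw [LinearEquiv.map_eq_zero_iff] at h1
    exact congrArg Subtype.val h1
  have hd0 : algebraMap (R ⧸ p.asIdeal) K d ≠ 0 :=
    (map_ne_zero_iff ι hι).2 (nonZeroDivisors.ne_zero d.2)
  exact (mul_eq_zero.1 hx).resolve_left hd0

variable [IsNoetherianRing R]

/-- Prime filtrations: a property that passes to extensions holds for a finitely generated
module as soon as it holds for `R / p`, for all `p` in its support. -/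
lemma induction_on_support {P : (N : Type u) → [AddCommGroup N] → [Module R N] → Prop}
    (subsingleton : ∀ (N : Type u) [AddCommGroup N] [Module R N] [Subsingleton N], P N)
    (exact : ∀ (N₁ N₂ N₃ : Type u) [AddCommGroup N₁] [Module R N₁] [Module.Finite R N₁]
      [AddCommGroup N₂] [Module R N₂] [Module.Finite R N₂]
      [AddCommGroup N₃] [Module R N₃] [Module.Finite R N₃] (f : N₁ →ₗ[R] N₂) (g : N₂ →ₗ[R] N₃),
      Function.Injective f → Function.Exact f g → Function.Surjective g → P N₁ → P N₃ → P N₂)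
    (N : Type u) [AddCommGroup N] [Module R N] [hN : Module.Finite R N]
    (h : ∀ p ∈ Module.support R N, P (R ⧸ p.asIdeal)) : P N := by
  induction hN using IsNoetherianRing.induction_on_isQuotientEquivQuotientPrime R with
  | subsingleton N => exact subsingleton N
  | quotient N p e =>
    have hp : P (R ⧸ p.asIdeal) := h p (by
      rw [e.support_eq, Module.mem_support_iff_of_finite, Ideal.annihilator_quotient])
    exact exact _ N PUnit e.symm.toLinearMap 0 e.symm.injective
      ((e.symm.toLinearMap.exact_zero_iff_surjective _).2 e.symm.surjective)
      (Function.surjective_to_subsingleton _) hp (subsingleton _)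
  | exact N₁ N₂ N₃ f g hf hg hfg h₁ h₃ =>
    rw [Module.support_of_exact hfg hf hg] at h
    exact exact N₁ N₂ N₃ f g hf hfg hg (h₁ fun p hp => h p (.inl hp)) (h₃ fun p hp => h p (.inr hp))

variable (a : Ideal R)

omit [IsNoetherianRing R] in
lemma natCast_le_pairFinitenessDim_iff {M L : Type u} [AddCommGroup M] [Module R M]
    [AddCommGroup L] [Module R L] {t : ℕ} :
    (t : ℕ∞) ≤ pairFinitenessDim a M L ↔
      ∀ i < t, Module.Finite R (genLocalCohomology a M L i) := by
  rw [pairFinitenessDim, le_iInf₂_iff]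
  simp only [Nat.cast_le]
  exact forall_congr' fun i => by rw [← not_imp_not, not_le, not_not]

variable (L : Type u) [AddCommGroup L] [Module R L]

lemma le_pairFinitenessDim_of_exact {t : ℕ} {M₁ M₂ M₃ : Type u} [AddCommGroup M₁] [Module R M₁]
    [AddCommGroup M₂] [Module R M₂] [Module.Finite R M₂] [AddCommGroup M₃] [Module R M₃]
    {f : M₁ →ₗ[R] M₂} {g : M₂ →ₗ[R] M₃} (hf : Function.Injective f) (hfg : Function.Exact f g)
    (hg : Function.Surjective g) (h₁ : (t : ℕ∞) ≤ pairFinitenessDim a M₁ L)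
    (h₃ : (t : ℕ∞) ≤ pairFinitenessDim a M₃ L) : (t : ℕ∞) ≤ pairFinitenessDim a M₂ L := by
  rw [natCast_le_pairFinitenessDim_iff] at *
  exact fun i hi => finite_genLocalCohomology_of_exact a hf hfg hg L i (h₁ i hi) (h₃ i hi)

/-- The bound `t + 1` passes from `M` to a quotient `N` when the kernel satisfies the bound `t`. -/
lemma succ_le_pairFinitenessDim_of_surjective {t : ℕ} {M N : Type u} [AddCommGroup M] [Module R M]
    [Module.Finite R M] [AddCommGroup N] [Module R N] {g : M →ₗ[R] N}
    (hg : Function.Surjective g) (hK : (t : ℕ∞) ≤ pairFinitenessDim a (LinearMap.ker g) L)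
    (hM : ((t + 1 : ℕ) : ℕ∞) ≤ pairFinitenessDim a M L) :
    ((t + 1 : ℕ) : ℕ∞) ≤ pairFinitenessDim a N L := by
  rw [natCast_le_pairFinitenessDim_iff] at *
  intro i hi
  cases i with
  | zero => exact finite_genLocalCohomology_zero_right a hg L (hM 0 hi)
  | succ i =>
    exact finite_genLocalCohomology_succ_right a (LinearMap.ker g).injective_subtype
      (LinearMap.exact_subtype_ker_map g) hg L i (hK i (by omega)) (hM (i + 1) hi)

variable [Module.Finite R L]

lemma pairFinitenessDim_eq_top_of_pow_smul_eq_bot (M : Type u) [AddCommGroup M] [Module R M]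
    [Module.Finite R M] {k : ℕ} (h : (a ^ k • ⊤ : Submodule R M) = ⊥) :
    pairFinitenessDim a M L = ⊤ := by
  rw [pairFinitenessDim, iInf₂_eq_top]
  exact fun i hi => absurd (finite_genLocalCohomology_of_pow_smul_eq_bot a M L h i) hi

lemma le_pairFinitenessDim_of_forall_mem_support {t : ℕ} (N : Type u) [AddCommGroup N] [Module R N]
    [Module.Finite R N]
    (h : ∀ p ∈ Module.support R N, (t : ℕ∞) ≤ pairFinitenessDim a (R ⧸ p.asIdeal) L) :
    (t : ℕ∞) ≤ pairFinitenessDim a N L := by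
  refine induction_on_support (P := fun N _ _ => (t : ℕ∞) ≤ pairFinitenessDim a N L)
    (fun N _ _ _ => ?_)
    (fun N₁ N₂ N₃ _ _ _ _ _ _ _ _ _ f g hf hfg hg h₁ h₃ =>
      le_pairFinitenessDim_of_exact a L hf hfg hg h₁ h₃) N h
  rw [pairFinitenessDim_eq_top_of_pow_smul_eq_bot a L N (k := 0) (Subsingleton.elim _ _)]
  exact le_top

/-- If `Supp N ⊆ Supp M`, then `f_a(M, L) ≤ f_a(N, L)`. -/
theorem pairFinitenessDim_le_of_support_subset (M N : Type u) [AddCommGroup M]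
    [Module R M] [Module.Finite R M] [AddCommGroup N] [Module R N] [Module.Finite R N]
    (h : Module.support R N ⊆ Module.support R M) :
    pairFinitenessDim a M L ≤ pairFinitenessDim a N L := by
  rw [← ENat.forall_natCast_le_iff_le]
  intro t
  induction t generalizing M N with
  | zero => simp
  | succ t ih =>
    intro hM
    have htM : (t : ℕ∞) ≤ pairFinitenessDim a M L := le_trans (by simp) hM
    -- Quotients of `M`: the kernel satisfies the bound for `t` by induction.
    have hquot (Q : Type u) [AddCommGroup Q] [Module R Q] (g : M →ₗ[R] Q)
        (hg : Function.Surjective g) : ((t + 1 : ℕ) : ℕ∞) ≤ pairFinitenessDim a Q L :=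
      succ_le_pairFinitenessDim_of_surjective a L hg (ih M (LinearMap.ker g)
        (Module.support_subset_of_injective _ (LinearMap.ker g).injective_subtype) htM) hM
    suffices hprime : ∀ p ∈ Module.support R M,
        ((t + 1 : ℕ) : ℕ∞) ≤ pairFinitenessDim a (R ⧸ p.asIdeal) L from
      le_pairFinitenessDim_of_forall_mem_support a L N fun p hp => hprime p (h hp)
    intro p
    induction p using (InvImage.wf PrimeSpectrum.asIdeal
      (wellFounded_gt (α := Ideal R))).induction with
    | h p ihp =>
    intro hp
    obtain ⟨φ, hφ⟩ := exists_ne_zero_of_mem_support hp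
    -- Both ends of `0 → im φ → R / p → coker φ → 0` satisfy the bound.
    refine le_pairFinitenessDim_of_exact a L (LinearMap.range φ).injective_subtype
      (LinearMap.exact_subtype_mkQ _) (Submodule.mkQ_surjective _)
      (hquot _ φ.rangeRestrict φ.surjective_rangeRestrict)
      (le_pairFinitenessDim_of_forall_mem_support a L _ fun q hq => ?_)
    -- The cokernel of `φ` is a proper quotient of `R / p`, so `q` strictly contains `p`.
    have hann := Module.annihilator_le_of_mem_support hq
    have hpq : p ≤ q := fun r hr => hann <| Module.mem_annihilator.2 fun x => by
      obtain ⟨x, rfl⟩ := Submodule.mkQ_surjective _ x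
      obtain ⟨x, rfl⟩ := Ideal.Quotient.mk_surjective x
      have hrx : r • Ideal.Quotient.mk p.asIdeal x = 0 :=
        Ideal.Quotient.eq_zero_iff_mem.2 (p.asIdeal.mul_mem_right x hr)
      rw [← map_smul, hrx, map_zero]
    refine ihp q (lt_of_le_of_ne hpq ?_) (Module.mem_support_mono hpq hp)
    intro hqp
    -- A representative of a nonzero value of `φ` kills `coker φ` but does not lie in `p`.
    obtain ⟨m, hm⟩ := DFunLike.ne_iff.1 hφ
    obtain ⟨r, hr⟩ := Ideal.Quotient.mk_surjective (φ m)
    have hrp : r ∉ q.asIdeal := fun h' => hm (by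
      rw [← hr, LinearMap.zero_apply, Ideal.Quotient.eq_zero_iff_mem]
      exact hqp.ge h')
    refine hrp (hann <| Module.mem_annihilator.2 fun x => ?_)
    obtain ⟨x, rfl⟩ := Submodule.mkQ_surjective _ x
    obtain ⟨x, rfl⟩ := Ideal.Quotient.mk_surjective x
    have hrx : r • Ideal.Quotient.mk p.asIdeal x = φ (x • m) := by
      rw [map_smul, ← hr, Algebra.smul_def, Algebra.smul_def]
      exact mul_comm _ _
    rw [← map_smul, hrx]
    exact (Submodule.Quotient.mk_eq_zero _).2 ⟨x • m, rfl⟩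

end Support

/-! ### Exact sequences, torsion and the first argument `R` -/

section Corollaries

variable {R : Type u} [CommRing R] [IsNoetherianRing R] (a : Ideal R)

lemma pairFinitenessDim_eq_min (L M N C : Type u) [AddCommGroup L] [Module R L] [Module.Finite R L]
    [AddCommGroup M] [Module R M] [Module.Finite R M]
    [AddCommGroup N] [Module R N] [Module.Finite R N]
    [AddCommGroup C] [Module R C] [Module.Finite R C]
    (f : L →ₗ[R] M) (g : M →ₗ[R] N) (hf : Function.Injective f) (hfg : Function.Exact f g)
    (hg : Function.Surjective g) :
    pairFinitenessDim a M C = min (pairFinitenessDim a L C) (pairFinitenessDim a N C) := by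
  refine le_antisymm (le_min ?_ ?_) ?_
  · exact pairFinitenessDim_le_of_support_subset a C M L (Module.support_subset_of_injective f hf)
  · exact pairFinitenessDim_le_of_support_subset a C M N (Module.support_subset_of_surjective g hg)
  · rw [← ENat.forall_natCast_le_iff_le]
    intro t ht
    exact le_pairFinitenessDim_of_exact a C hf hfg hg (ht.trans (min_le_left _ _))
      (ht.trans (min_le_right _ _))

omit [IsNoetherianRing R] in
/-- `f_a(M) = f_a(R, M)`. -/
lemma finitenessDim_eq_pairFinitenessDim (M : Type u) [AddCommGroup M] [Module R M] :
    finitenessDim a M = pairFinitenessDim a R M := by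
  have h (i : ℕ) : Module.Finite R ((localCohomology a i).obj (ModuleCat.of R M)) ↔
      Module.Finite R (genLocalCohomology a R M i) :=
    let ⟨e⟩ := nonempty_genLocalCohomology_equiv_localCohomology a M i
    ⟨fun _ => Module.Finite.equiv e.symm, fun _ => Module.Finite.equiv e⟩
  simp only [finitenessDim, pairFinitenessDim, h]

lemma pairFinitenessDim_self_le (C M : Type u) [AddCommGroup C] [Module R C] [Module.Finite R C]
    [AddCommGroup M] [Module R M] [Module.Finite R M] :
    pairFinitenessDim a R M ≤ pairFinitenessDim a C M :=
  pairFinitenessDim_le_of_support_subset a M R C fun p _ => by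
    rw [Module.mem_support_iff_of_finite, Module.annihilator_eq_bot.2 inferInstance]
    exact bot_le

/-- The submodule `Γ_a(M)` is killed by a power of `a`, hence does not contribute. -/
lemma pairFinitenessDim_quotient_primaryComponent (L M : Type u) [AddCommGroup L] [Module R L]
    [Module.Finite R L] [AddCommGroup M] [Module R M] [Module.Finite R M] :
    pairFinitenessDim a (M ⧸ Ideal.primaryComponent M a) L = pairFinitenessDim a M L := by
  obtain ⟨k, hk⟩ : ∃ k : ℕ, (a ^ k • ⊤ : Submodule R (Ideal.primaryComponent M a)) = ⊥ := by
    obtain ⟨s, hs⟩ := Module.Finite.fg_top (R := R) (M := Ideal.primaryComponent M a)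
    have h (x : Ideal.primaryComponent M a) : ∃ n : ℕ, ∀ r ∈ a ^ n, r • x = 0 := by
      obtain ⟨n, hn⟩ := (Ideal.primaryComponent_mem M a x.1).1 x.2
      rw [Submodule.mem_torsionBySet_iff] at hn
      exact ⟨n, fun r hr => Subtype.ext (hn ⟨r, hr⟩)⟩
    choose n hn using h
    refine ⟨s.sup n, ?_⟩
    rw [eq_bot_iff, Submodule.smul_le]
    intro r hr x _
    have hker : (⊤ : Submodule R (Ideal.primaryComponent M a)) ≤
        LinearMap.ker (LinearMap.lsmul R (Ideal.primaryComponent M a) r) := by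
      rw [← hs, Submodule.span_le]
      exact fun y hy => hn y r (Ideal.pow_le_pow_right (Finset.le_sup hy) hr)
    exact hker (Submodule.mem_top (x := x))
  rw [pairFinitenessDim_eq_min a _ M _ L _ _ (Ideal.primaryComponent M a).injective_subtype
    (LinearMap.exact_subtype_mkQ _) (Submodule.mkQ_surjective _),
    pairFinitenessDim_eq_top_of_pow_smul_eq_bot a L _ hk, min_eq_right le_top]

end Corollaries

end

theorem corollary2p2 {R : Type u} [CommRing R] [IsNoetherianRing R] (a : Ideal R) :
    -- (i)
    (∀ (L M N C : Type u) [AddCommGroup L] [Module R L] [Module.Finite R L]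
      [AddCommGroup M] [Module R M] [Module.Finite R M]
      [AddCommGroup N] [Module R N] [Module.Finite R N]
      [AddCommGroup C] [Module R C] [Module.Finite R C]
      (f : L →ₗ[R] M) (g : M →ₗ[R] N),
      Function.Injective f → Function.Exact f g → Function.Surjective g →
        pairFinitenessDim a M C = min (pairFinitenessDim a L C) (pairFinitenessDim a N C)) ∧
    -- (ii)
    (∀ (M : Type u) [AddCommGroup M] [Module R M] [Module.Finite R M],
      finitenessDim a M =
        ⨅ (C : ModuleCat.{u} R) (_ : Module.Finite R C), pairFinitenessDim a C M) ∧
    -- (iii)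
    (∀ (L M : Type u) [AddCommGroup L] [Module R L] [Module.Finite R L]
      [AddCommGroup M] [Module R M] [Module.Finite R M],
      pairFinitenessDim a M L =
        ⨅ p ∈ Module.support R M, pairFinitenessDim a (R ⧸ p.asIdeal) L) ∧
    -- (iv); `Ideal.primaryComponent M a` is the submodule `Γ_a(M)` of elements killed by some `aⁿ`
    (∀ (L M N : Type u) [AddCommGroup L] [Module R L] [Module.Finite R L]
      [AddCommGroup M] [Module R M] [Module.Finite R M]
      [AddCommGroup N] [Module R N] [Module.Finite R N],
      (Module.support R (M ⧸ Ideal.primaryComponent M a) ⊆ Module.support R (N ⧸ Ideal.primaryComponent N a) →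
        pairFinitenessDim a N L ≤ pairFinitenessDim a M L) ∧
      (Module.support R (M ⧸ Ideal.primaryComponent M a) = Module.support R (N ⧸ Ideal.primaryComponent N a) →
        pairFinitenessDim a M L = pairFinitenessDim a N L)) := by
  have h4 (L M N : Type u) [AddCommGroup L] [Module R L] [Module.Finite R L]
      [AddCommGroup M] [Module R M] [Module.Finite R M]
      [AddCommGroup N] [Module R N] [Module.Finite R N]
      (h : Module.support R (M ⧸ Ideal.primaryComponent M a) ⊆
        Module.support R (N ⧸ Ideal.primaryComponent N a)) :
      pairFinitenessDim a N L ≤ pairFinitenessDim a M L := by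
    rw [← pairFinitenessDim_quotient_primaryComponent a L M,
      ← pairFinitenessDim_quotient_primaryComponent a L N]
    exact pairFinitenessDim_le_of_support_subset a L _ _ h
  refine ⟨?_, fun M _ _ _ => ?_, fun L M _ _ _ _ _ _ => ?_, fun L M N _ _ _ _ _ _ _ _ _ =>
    ⟨h4 L M N, fun h => le_antisymm (h4 L N M h.ge) (h4 L M N h.le)⟩⟩
  · intro L M N C _ _ _ _ _ _ _ _ _ _ _ _ f g hf hfg hg
    exact pairFinitenessDim_eq_min a L M N C f g hf hfg hg
  · rw [finitenessDim_eq_pairFinitenessDim]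
    exact le_antisymm (le_iInf₂ fun C _ => pairFinitenessDim_self_le a C M)
      (iInf₂_le (f := fun (C : ModuleCat.{u} R) (_ : Module.Finite R C) => pairFinitenessDim a C M)
        (ModuleCat.of R R) (inferInstanceAs (Module.Finite R R)))
  · refine le_antisymm (le_iInf₂ fun p hp => ?_) ?_
    · refine pairFinitenessDim_le_of_support_subset a L M _ fun q hq => ?_
      have hann := Module.annihilator_le_of_mem_support hq
      rw [Ideal.annihilator_quotient] at hann
      exact Module.mem_support_mono hann hp
    · rw [← ENat.forall_natCast_le_iff_le]
      exact fun t ht => le_pairFinitenessDim_of_forall_mem_support a L M fun p hp =>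
        ht.trans (iInf₂_le p hp)
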